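/- Let $0<\kappa<1$. Let $F={}_2F_1$ be the Gaussian hypergeometric function, and let $\phi:\mathbb R\to\mathbb R$ be the inverse of the increasing bijection $\mathbb R\to\mathbb R$, $T\mapsto\int_0^T F(\tfrac14,\tfrac34;\tfrac12;\kappa^2\sin^2 t)\,dt$. Put $\psi=\arcsin(\kappa\sin\phi)$ and $\mathrm{rn}=\sin(\tfrac12\psi):\mathbb R\to\mathbb R$. There is a lattice in $\mathbb C$ whose Weierstrass invariants are $$G_2=\tfrac1{12}(1+3\kappa^2),\qquad G_3=\tfrac1{216}(1-9\kappa^2);$$ let $P=\wp(\,\cdot\,;G_2,G_3)$ be the Weierstrass function of such a lattice $\Lambda$. Then $$\mathrm{rn}=\frac{\frac14\kappa P'}{(\frac14\kappa)^2-(\frac1{12}+P)^2}=\frac{\frac14\kappa P'}{(\frac14\kappa-\frac1{12}-P)(\frac14\kappa+\frac1{12}+P)}$$ at every real point that is not in $\Lambda$ (the denominators do not vanish there). Moreover $\mathrm{rn}$ extends from $\mathbb R$ to an elliptic function on $\mathbb C$ (meromorphic on $\mathbb C$, analytic at each point of $\mathbb R$, with all elements of $\Lambda$ as periods), and this extension is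 given by the same formulas at every $z\in\mathbb C\setminus\Lambda$ at which the denominator does not vanish. -/

import Mathlib

open Filter Topology MeasureTheory

noncomputable section

/-- The integrand `F(1/4, 3/4; 1/2; κ² sin² t)`, with `F` the Gaussian hypergeometric function. -/
def sigFourIntegrand (κ t : ℝ) : ℝ :=
  ordinaryHypergeometric (1 / 4 : ℝ) (3 / 4 : ℝ) (1 / 2 : ℝ) (κ ^ 2 * Real.sin t ^ 2)

/-- The incomplete integral `T ↦ ∫₀ᵀ F(1/4, 3/4; 1/2; κ² sin² t) dt`. -/
def sigFourIntegral (κ T : ℝ) : ℝ :=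
  ∫ t in (0 : ℝ)..T, sigFourIntegrand κ t

/-- `φ : ℝ → ℝ`, the inverse of the bijection `T ↦ ∫₀ᵀ F(1/4, 3/4; 1/2; κ² sin² t) dt`. For
`0 < κ < 1` that map is a bijection: see `sigFourIntegral_bijective`, `sigFourIntegral_phi`. -/
def sigFourPhi (κ : ℝ) : ℝ → ℝ :=
  Function.invFun (sigFourIntegral κ)

/-- `ψ = arcsin (κ sin φ)`. -/
def sigFourPsi (κ u : ℝ) : ℝ :=
  Real.arcsin (κ * Real.sin (sigFourPhi κ u))

/-- The root function `rn = sin (ψ / 2)` on the real line. -/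
def rn (κ u : ℝ) : ℝ :=
  Real.sin (sigFourPsi κ u / 2)

/-- `f` is an elliptic function on `ℂ` having every element of the lattice of `L` as a period: it
is meromorphic in the plane and doubly periodic. Normal form means that at each point `f` is either
analytic or has a pole, where it takes the default value `0` (so there are no removable
singularities and no arbitrary values at poles). -/
def IsEllipticWith (L : PeriodPair) (f : ℂ → ℂ) : Prop :=
  MeromorphicNFOn f Set.univ ∧ ∀ l ∈ L.lattice, ∀ z : ℂ, f (z + l) = f z

lemma sigFour_radius :
    (ordinaryHypergeometricSeries ℝ (1 / 4 : ℝ) (3 / 4 : ℝ) (1 / 2 : ℝ)).radius = 1 := by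
  apply ordinaryHypergeometricSeries_radius_eq_one
  intro k
  have hk : (0 : ℝ) ≤ k := k.cast_nonneg
  refine ⟨?_, ?_, ?_⟩ <;> intro h <;> linarith

lemma sigFour_arg_mem {κ : ℝ} (h0 : 0 < κ) (h1 : κ < 1) (t : ℝ) :
    0 ≤ κ ^ 2 * Real.sin t ^ 2 ∧ κ ^ 2 * Real.sin t ^ 2 < 1 := by
  refine ⟨by positivity, ?_⟩
  have h2 : κ ^ 2 < 1 := by nlinarith
  have h3 := Real.sin_sq_le_one t
  have h4 := sq_nonneg (Real.sin t)
  nlinarith [sq_nonneg κ]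

lemma sigFourIntegrand_continuous {κ : ℝ} (h0 : 0 < κ) (h1 : κ < 1) :
    Continuous (sigFourIntegrand κ) := by
  have hp := (ordinaryHypergeometricSeries ℝ (1 / 4 : ℝ) (3 / 4 : ℝ)
    (1 / 2 : ℝ)).hasFPowerSeriesOnBall (by rw [sigFour_radius]; exact one_pos)
  have hc := hp.continuousOn
  rw [sigFour_radius] at hc
  refine hc.comp_continuous (f := fun t => κ ^ 2 * Real.sin t ^ 2) (by fun_prop) fun t => ?_
  obtain ⟨ha, hb⟩ := sigFour_arg_mem h0 h1 t
  rw [← ENNReal.ofReal_one, Metric.eball_ofReal, Metric.mem_ball, dist_zero_right,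
    Real.norm_of_nonneg ha]
  exact hb

lemma one_le_sigFourIntegrand {κ : ℝ} (h0 : 0 < κ) (h1 : κ < 1) (t : ℝ) :
    1 ≤ sigFourIntegrand κ t := by
  obtain ⟨ha, hb⟩ := sigFour_arg_mem h0 h1 t
  set x := κ ^ 2 * Real.sin t ^ 2 with hx
  have hp := (ordinaryHypergeometricSeries ℝ (1 / 4 : ℝ) (3 / 4 : ℝ)
    (1 / 2 : ℝ)).hasFPowerSeriesOnBall (by rw [sigFour_radius]; exact one_pos)
  rw [sigFour_radius] at hp
  have hs := hp.hasSum (y := x) (by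
    rw [← ENNReal.ofReal_one, Metric.eball_ofReal, Metric.mem_ball, dist_zero_right,
      Real.norm_of_nonneg ha]
    exact hb)
  rw [zero_add] at hs
  have h := hs.summable.le_tsum 0 (fun n _ => ?_)
  · rw [hs.tsum_eq] at h
    rw [ordinaryHypergeometricSeries_apply_eq] at h
    simp only [Nat.factorial_zero, Nat.cast_one, inv_one, ascPochhammer_zero,
      Polynomial.eval_one, mul_one, pow_zero, smul_eq_mul] at h
    exact h
  · rw [ordinaryHypergeometricSeries_apply_eq, smul_eq_mul]
    have e1 := ascPochhammer_pos n (1 / 4 : ℝ) (by norm_num)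
    have e2 := ascPochhammer_pos n (3 / 4 : ℝ) (by norm_num)
    have e3 := ascPochhammer_pos n (1 / 2 : ℝ) (by norm_num)
    positivity

lemma sigFourIntegral_sub {κ : ℝ} (h0 : 0 < κ) (h1 : κ < 1) {S T : ℝ} (h : S ≤ T) :
    T - S ≤ sigFourIntegral κ T - sigFourIntegral κ S := by
  have hc := sigFourIntegrand_continuous h0 h1
  unfold sigFourIntegral
  rw [intervalIntegral.integral_interval_sub_left (hc.intervalIntegrable _ _)
    (hc.intervalIntegrable _ _)]
  have := intervalIntegral.integral_mono_on h
    (intervalIntegrable_const (c := (1 : ℝ)) (μ := volume)) (hc.intervalIntegrable S T)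
    (fun t _ => one_le_sigFourIntegrand h0 h1 t)
  simpa using this

lemma sigFourIntegral_bijective {κ : ℝ} (h0 : 0 < κ) (h1 : κ < 1) :
    Function.Bijective (sigFourIntegral κ) := by
  have hz : sigFourIntegral κ 0 = 0 := by simp [sigFourIntegral]
  constructor
  · apply StrictMono.injective
    intro S T h
    have := sigFourIntegral_sub h0 h1 h.le
    linarith
  · apply Continuous.surjective
    · exact intervalIntegral.continuous_primitive
        (fun a b => (sigFourIntegrand_continuous h0 h1).intervalIntegrable a b) 0
    · refine tendsto_atTop_mono' atTop ?_ tendsto_id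
      filter_upwards [eventually_ge_atTop 0] with T hT
      have := sigFourIntegral_sub h0 h1 hT
      simp only [id]
      linarith
    · refine tendsto_atBot_mono' atBot ?_ tendsto_id
      filter_upwards [eventually_le_atBot 0] with T hT
      have := sigFourIntegral_sub h0 h1 hT
      simp only [id]
      linarith

/-- The defining property of `φ`: `u = ∫₀^{φ(u)} F(1/4, 3/4; 1/2; κ² sin² t) dt`. -/
lemma sigFourIntegral_phi {κ : ℝ} (h0 : 0 < κ) (h1 : κ < 1) (u : ℝ) :
    sigFourIntegral κ (sigFourPhi κ u) = u :=
  Function.rightInverse_invFun (sigFourIntegral_bijective h0 h1).2 u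

end

/-! Both functions solve the same initial value problem. On the real side, F(1/4, 3/4; 1/2; s²) is
the even part of (1 + s)^(-1/2). For s = sin ψ = κ sin φ this is cos(ψ/2) / cos ψ, whence rn' =
(κ/2) cos φ and rn'' = 2 rn³ - rn, with rn(0) = 0 and rn'(0) = κ/2.

On the elliptic side put a = κ/4 and x = 1/12 + ℘. The invariants are exactly those with ℘'² = (4x -
1)(x² - a²), and then a℘'/(a² - x²) satisfies the same equation, with a removable singularity and
the same data at 0. Its normal form `R` equals rn along ℝ (`analyticAt_and_eq_rnCurve`): ODE
uniqueness spreads the equality locally, and local boundedness of rn excludes poles. Where `R` is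
analytic off the lattice, the denominator cannot vanish (`denom_ne_zero_of_analyticAt`).

The lattice exists because E₆²/E₄³ takes the required value: a level one form of positive weight
that is nonzero at the cusp has a zero in the upper half plane. -/

/-! ### Closed form of the hypergeometric integrand -/

/-- Duplication of Pochhammer symbols: (1/4)ₙ(3/4)ₙ = (1/2)₂ₙ/4ⁿ and (1/2)ₙ n! = (2n)!/4ⁿ. -/
lemma sigFour_coefficient_eq_choose (n : ℕ) :
    ordinaryHypergeometricCoefficient (1 / 4 : ℝ) (3 / 4) (1 / 2) n =
      Ring.choose (-(1 / 2) : ℝ) (2 * n) := by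
  have h : Ring.choose (-(1 / 2) : ℝ) (2 * n) =
      ((2 * n).factorial : ℝ)⁻¹ * (ascPochhammer ℝ (2 * n)).eval (1 / 2) := by
    have := ascPochhammer_eval_neg_eq_descPochhammer ℝ (-(1 / 2)) (2 * n)
    rw [neg_neg] at this
    simp only [Ring.choose_eq_smul, Polynomial.descPochhammer_smeval_eq_ascPochhammer,
      Polynomial.ascPochhammer_smeval_cast, Polynomial.ascPochhammer_smeval_eq_eval]
    rw [descPochhammer_eval_eq_ascPochhammer] at this
    rw [this]
    simp
  rw [h]
  clear h
  unfold ordinaryHypergeometricCoefficient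
  induction n with
  | zero => simp
  | succ n ih =>
    have e3 := (ascPochhammer_pos n (1 / 2 : ℝ) (by norm_num)).ne'
    have f1 : (n.factorial : ℝ) ≠ 0 := by positivity
    have f2 : ((2 * n).factorial : ℝ) ≠ 0 := by positivity
    rw [show 2 * (n + 1) = 2 * n + 1 + 1 by ring]
    simp only [ascPochhammer_succ_eval, Nat.factorial_succ]
    push_cast
    field_simp at ih ⊢
    linear_combination 16 * (4 * (n : ℝ) + 1) * (4 * n + 3) * (2 * n + 1) * (n + 1) * ih

lemma ordinaryHypergeometric_quarter_sq {s : ℝ} (hs : |s| < 1) :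
    ordinaryHypergeometric (1 / 4 : ℝ) (3 / 4 : ℝ) (1 / 2 : ℝ) (s ^ 2) =
      ((1 + s) ^ (-(1 / 2) : ℝ) + (1 - s) ^ (-(1 / 2) : ℝ)) / 2 := by
  have key : ∀ x : ℝ, |x| < 1 →
      HasSum (fun n : ℕ => Ring.choose (-(1 / 2) : ℝ) n * x ^ n) ((1 + x) ^ (-(1 / 2) : ℝ)) := by
    intro x hx
    have h := (Real.one_add_rpow_hasFPowerSeriesOnBall_zero (a := -(1 / 2))).hasSum (y := x) (by
      rw [← ENNReal.ofReal_one, Metric.eball_ofReal, Metric.mem_ball, dist_zero_right]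
      exact hx)
    simpa only [binomialSeries_apply, List.ofFn_const, List.prod_replicate, smul_eq_mul, zero_add]
      using h
  have h1 := ((key s hs).add (key (-s) (by rwa [abs_neg]))).div_const 2
  rw [← sub_eq_add_neg] at h1
  have h2 : HasSum (fun n : ℕ => Ring.choose (-(1 / 2) : ℝ) (2 * n) * s ^ (2 * n))
      (((1 + s) ^ (-(1 / 2) : ℝ) + (1 - s) ^ (-(1 / 2) : ℝ)) / 2) := by
    -- The odd terms of the series at s and -s cancel, so only even indices contribute.
    have hinj : Function.Injective fun n : ℕ => 2 * n := fun a b h => by simpa using h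
    rw [← hinj.hasSum_iff] at h1
    · convert! h1 using 2 with n
      simp [pow_mul]
    · intro m hm
      have : Odd m := by
        rw [← Nat.not_even_iff_odd]
        rintro ⟨k, rfl⟩
        exact hm ⟨k, by ring⟩
      simp [this.neg_pow]
  rw [ordinaryHypergeometric_eq_tsum, ← h2.tsum_eq]
  refine tsum_congr fun n => ?_
  rw [← sigFour_coefficient_eq_choose, pow_mul, smul_eq_mul]

/-- With C, S the cosine and sine of ψ/2, 1 ± sin ψ = (C ± S)² and cos ψ = (C + S)(C - S); both
factors are positive for |ψ| < π/2. -/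
lemma sigFourIntegrand_eq {κ ψ t : ℝ} (hψ : |ψ| < Real.pi / 2)
    (h : Real.sin ψ = κ * Real.sin t) :
    sigFourIntegrand κ t = Real.cos (ψ / 2) / Real.cos ψ := by
  obtain ⟨l, u⟩ := abs_lt.1 hψ
  have hc : 0 < Real.cos ψ := Real.cos_pos_of_mem_Ioo ⟨l, u⟩
  have h1 := Real.sin_sq_add_cos_sq ψ
  have hs : |Real.sin ψ| < 1 := by
    rw [← sq_lt_one_iff_abs_lt_one]; nlinarith
  rw [sigFourIntegrand, ← mul_pow, ← h, ordinaryHypergeometric_quarter_sq hs]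
  have e1 := Real.sin_two_mul (ψ / 2)
  have e2 := Real.cos_two_mul (ψ / 2)
  have e3 := Real.sin_sq_add_cos_sq (ψ / 2)
  rw [mul_div_cancel₀ _ two_ne_zero] at e1 e2
  have hC : 0 < Real.cos (ψ / 2) := Real.cos_pos_of_mem_Ioo ⟨by linarith, by linarith⟩
  set S := Real.sin (ψ / 2)
  set C := Real.cos (ψ / 2)
  have hprod : 0 < (C + S) * (C - S) := by nlinarith
  have hp : 0 < C + S := by
    by_contra! hn
    nlinarith
  have hm : 0 < C - S := pos_of_mul_pos_right hprod hp.le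
  have r : ∀ x : ℝ, 0 < x → (x ^ 2) ^ (-(1 / 2) : ℝ) = x⁻¹ := by
    intro x hx
    rw [Real.rpow_neg (by positivity), ← Real.sqrt_eq_rpow, Real.sqrt_sq hx.le]
  rw [show 1 + Real.sin ψ = (C + S) ^ 2 by rw [e1]; linear_combination -e3,
    show 1 - Real.sin ψ = (C - S) ^ 2 by rw [e1]; linear_combination -e3, r _ hp, r _ hm,
    show Real.cos ψ = (C + S) * (C - S) by rw [e2]; linear_combination e3]
  field_simp
  ring

/-! ### The differential equation of rn on the real line -/

lemma abs_mul_sin_lt_one {κ : ℝ} (h0 : 0 < κ) (h1 : κ < 1) (t : ℝ) : |κ * Real.sin t| < 1 := by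
  rw [abs_mul, abs_of_pos h0]
  have := Real.abs_sin_le_one t
  nlinarith [abs_nonneg (Real.sin t)]

lemma abs_sigFourPsi_lt {κ : ℝ} (h0 : 0 < κ) (h1 : κ < 1) (u : ℝ) :
    |sigFourPsi κ u| < Real.pi / 2 := by
  obtain ⟨l, r⟩ := abs_lt.1 (abs_mul_sin_lt_one h0 h1 (sigFourPhi κ u))
  exact abs_lt.2 ⟨Real.neg_pi_div_two_lt_arcsin.2 l, Real.arcsin_lt_pi_div_two.2 r⟩

lemma sin_sigFourPsi {κ : ℝ} (h0 : 0 < κ) (h1 : κ < 1) (u : ℝ) :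
    Real.sin (sigFourPsi κ u) = κ * Real.sin (sigFourPhi κ u) := by
  obtain ⟨l, r⟩ := abs_lt.1 (abs_mul_sin_lt_one h0 h1 (sigFourPhi κ u))
  exact Real.sin_arcsin l.le r.le

lemma sigFourPhi_zero {κ : ℝ} (h0 : 0 < κ) (h1 : κ < 1) : sigFourPhi κ 0 = 0 := by
  apply (sigFourIntegral_bijective h0 h1).1
  rw [sigFourIntegral_phi h0 h1]
  simp [sigFourIntegral]

/-- The integrand is at least 1, so the inverse of the integral is 1-Lipschitz. The resulting
continuity is what differentiating the inverse requires. -/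
lemma lipschitzWith_sigFourPhi {κ : ℝ} (h0 : 0 < κ) (h1 : κ < 1) :
    LipschitzWith 1 (sigFourPhi κ) := by
  refine LipschitzWith.of_dist_le_mul fun u v => ?_
  rw [NNReal.coe_one, one_mul, Real.dist_eq, Real.dist_eq]
  rcases le_total (sigFourPhi κ u) (sigFourPhi κ v) with h | h
  · have := sigFourIntegral_sub h0 h1 h
    rw [sigFourIntegral_phi h0 h1, sigFourIntegral_phi h0 h1] at this
    rw [abs_of_nonpos (by linarith), abs_of_nonpos (by linarith)]
    linarith
  · have := sigFourIntegral_sub h0 h1 h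
    rw [sigFourIntegral_phi h0 h1, sigFourIntegral_phi h0 h1] at this
    rw [abs_of_nonneg (by linarith), abs_of_nonneg (by linarith)]
    linarith

lemma hasDerivAt_sigFourPhi {κ : ℝ} (h0 : 0 < κ) (h1 : κ < 1) (u : ℝ) :
    HasDerivAt (sigFourPhi κ)
      (Real.cos (sigFourPsi κ u) / Real.cos (sigFourPsi κ u / 2)) u := by
  have hc := sigFourIntegrand_continuous h0 h1
  have hd : HasDerivAt (sigFourIntegral κ) (sigFourIntegrand κ (sigFourPhi κ u))
      (sigFourPhi κ u) :=
    intervalIntegral.integral_hasDerivAt_right (hc.intervalIntegrable _ _)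
      (hc.stronglyMeasurableAtFilter _ _) hc.continuousAt
  have h := HasDerivAt.of_local_left_inverse
    (lipschitzWith_sigFourPhi h0 h1).continuous.continuousAt hd
    (by linarith [one_le_sigFourIntegrand h0 h1 (sigFourPhi κ u)])
    (Eventually.of_forall (sigFourIntegral_phi h0 h1))
  rwa [sigFourIntegrand_eq (abs_sigFourPsi_lt h0 h1 u) (sin_sigFourPsi h0 h1 u), inv_div] at h

/-- The derivative of `rn`. -/
noncomputable def rnDeriv (κ u : ℝ) : ℝ :=
  κ / 2 * Real.cos (sigFourPhi κ u)

lemma hasDerivAt_rn {κ : ℝ} (h0 : 0 < κ) (h1 : κ < 1) (u : ℝ) :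
    HasDerivAt (rn κ) (rnDeriv κ u) u := by
  obtain ⟨l, r⟩ := abs_lt.1 (abs_mul_sin_lt_one h0 h1 (sigFourPhi κ u))
  obtain ⟨l', r'⟩ := abs_lt.1 (abs_sigFourPsi_lt h0 h1 u)
  have hc : 0 < Real.cos (sigFourPsi κ u) := Real.cos_pos_of_mem_Ioo ⟨l', r'⟩
  have hC : 0 < Real.cos (sigFourPsi κ u / 2) :=
    Real.cos_pos_of_mem_Ioo ⟨by linarith, by linarith⟩
  have hψ : HasDerivAt (sigFourPsi κ) _ u :=
    (Real.hasDerivAt_arcsin (by linarith) (by linarith)).comp u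
      (((hasDerivAt_sigFourPhi h0 h1 u).sin).const_mul κ)
  have h := (hψ.div_const 2).sin
  refine h.congr_deriv ?_
  have e : √(1 - (κ * Real.sin (sigFourPhi κ u)) ^ 2) = Real.cos (sigFourPsi κ u) := by
    rw [sigFourPsi, Real.cos_arcsin]
  rw [e, rnDeriv]
  field_simp

/-- Since κ sin φ = sin ψ = 2 sin(ψ/2) cos(ψ/2), the derivative is -sin(ψ/2) cos ψ, and cos ψ = 1 -
2 rn². -/
lemma hasDerivAt_rnDeriv {κ : ℝ} (h0 : 0 < κ) (h1 : κ < 1) (u : ℝ) :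
    HasDerivAt (rnDeriv κ) (2 * rn κ u ^ 3 - rn κ u) u := by
  obtain ⟨l', r'⟩ := abs_lt.1 (abs_sigFourPsi_lt h0 h1 u)
  have hC : 0 < Real.cos (sigFourPsi κ u / 2) :=
    Real.cos_pos_of_mem_Ioo ⟨by linarith, by linarith⟩
  refine (((hasDerivAt_sigFourPhi h0 h1 u).cos).const_mul (κ / 2)).congr_deriv ?_
  have e1 := Real.sin_two_mul (sigFourPsi κ u / 2)
  have e2 := Real.cos_two_mul (sigFourPsi κ u / 2)
  have e3 := Real.sin_sq_add_cos_sq (sigFourPsi κ u / 2)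
  rw [mul_div_cancel₀ _ two_ne_zero] at e1 e2
  rw [sin_sigFourPsi h0 h1] at e1
  rw [rn, e2]
  field_simp
  set S := Real.sin (sigFourPsi κ u / 2)
  set C := Real.cos (sigFourPsi κ u / 2)
  have e4 : C ^ 2 = 1 - S ^ 2 := by linear_combination e3
  rw [e4]
  linear_combination (-(2 * (1 - S ^ 2) - 1)) * e1

lemma rn_zero {κ : ℝ} (h0 : 0 < κ) (h1 : κ < 1) : rn κ 0 = 0 := by
  simp [rn, sigFourPsi, sigFourPhi_zero h0 h1]

lemma rnDeriv_zero {κ : ℝ} (h0 : 0 < κ) (h1 : κ < 1) : rnDeriv κ 0 = κ / 2 := by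
  simp [rnDeriv, sigFourPhi_zero h0 h1]

/-! ### Existence of a lattice with given invariants -/

section LatticeExistence

open UpperHalfPlane ModularForm ModularFormClass MatrixGroups EisensteinSeries

/-- A level one modular form of positive weight which does not vanish at the cusp has a zero. -/
lemma ModularForm.exists_apply_eq_zero_of_levelOne {k : ℤ} (hk : 0 < k) (f : ModularForm 𝒮ℒ k)
    {c : ℂ} (hc : c ≠ 0) (hf : Tendsto f atImInfty (𝓝 c)) : ∃ τ : ℍ, f τ = 0 := by
  -- Without zeros, 1/f would be a modular form of weight -k, bounded at the cusp because c ≠ 0;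
  -- negative weight forces it to be 0.
  by_contra! hne
  have hslash (γ : SL(2, ℤ)) : (fun z ↦ 1 / f z) ∣[-k] γ = fun z ↦ 1 / f z := by
    have hγ : (γ : GL (Fin 2) ℝ) ∈ 𝒮ℒ := ⟨γ, rfl⟩
    have h1 : ((1 : ℍ → ℂ) / ⇑f) ∣[(0 : ℤ) - k] γ = 1 / ⇑f := by
      rw [div_slash_SL2, ModularForm.is_invariant_one, SL_slash,
        SlashInvariantForm.slash_action_eqn f _ hγ]
    rw [zero_sub] at h1
    exact h1
  let g : ModularForm 𝒮ℒ (-k) :=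
    { toFun z := 1 / f z
      slash_action_eq' := fun _ ⟨γ, hγ⟩ ↦ hγ ▸ hslash γ
      holo' := mdifferentiable_const.div f.holo' hne
      bdd_at_cusps' {c'} hc' := by
        rw [Subgroup.IsArithmetic.isCusp_iff_isCusp_SL2Z] at hc'
        rw [OnePoint.isBoundedAt_iff_forall_SL2Z hc']
        intro γ _
        rw [hslash γ, IsBoundedAtImInfty, BoundedAtFilter]
        exact (tendsto_const_nhds.div hf hc).isBigO_one ℝ }
  have hg := ModularFormClass.levelOne_neg_weight_eq_zero (by lia) g
  have : 1 / f I = 0 := congrFun hg I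
  simp [hne I] at this

lemma ModularForm.tendsto_E_atImInfty {k : ℕ} (hk : 3 ≤ k) (hk2 : Even k) :
    Tendsto (E hk) atImInfty (𝓝 1) := by
  have hc := ModularFormClass.analyticAt_cuspFunction_zero (E hk) one_pos one_mem_strictPeriods_SL
  have h := hc.continuousAt.tendsto.comp (qParam_tendsto_atImInfty one_pos)
  have h0 := E_qExpansion_coeff_zero hk hk2
  rw [qExpansion_coeff, Nat.factorial_zero, iteratedDeriv_zero, Nat.cast_one, inv_one,
    one_mul] at h0
  rw [h0] at h
  refine h.congr fun τ => ?_
  exact SlashInvariantFormClass.eq_cuspFunction (E hk) τ one_mem_strictPeriods_SL one_ne_zero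

/-- The weight 12 form A E₆² - B E₄³ tends to A - B ≠ 0 at the cusp. -/
lemma exists_E₆_sq_eq_E₄_cube {A B : ℂ} (h : A ≠ B) :
    ∃ τ : ℍ, A * E₆ τ ^ 2 = B * E₄ τ ^ 3 := by
  let f : ModularForm 𝒮ℒ 12 :=
    A • ModularForm.mcast (by decide) (E₆.pow 2) - B • ModularForm.mcast (by decide) (E₄.pow 3)
  have hf (z : ℍ) : f z = A * E₆ z ^ 2 - B * E₄ z ^ 3 := by
    have h6 := congrFun (ModularForm.coe_pow E₆ 2) z
    have h4 := congrFun (ModularForm.coe_pow E₄ 3) z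
    rw [Pi.pow_apply] at h4 h6
    rw [← h4, ← h6]
    simp [f]
  obtain ⟨τ, hτ⟩ := ModularForm.exists_apply_eq_zero_of_levelOne (by norm_num) f
    (sub_ne_zero.2 h) (by
      rw [show (f : ℍ → ℂ) = _ from funext hf]
      have e4 := ModularForm.tendsto_E_atImInfty (k := 4) (by norm_num) ⟨2, rfl⟩
      have e6 := ModularForm.tendsto_E_atImInfty (k := 6) (by norm_num) ⟨3, rfl⟩
      simpa using ((e6.pow 2).const_mul A).sub ((e4.pow 3).const_mul B))
  exact ⟨τ, sub_eq_zero.1 (hf τ ▸ hτ)⟩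

/-- The lattice `c (ℤ τ + ℤ)`. -/
noncomputable def PeriodPair.ofUpperHalfPlane (τ : ℍ) (c : ℂ) (hc : c ≠ 0) : PeriodPair where
  ω₁ := c * τ
  ω₂ := c
  indep := by
    rw [LinearIndependent.pair_iff]
    intro s t h
    simp only [Complex.real_smul] at h
    have h1 : (s : ℂ) * τ + t = 0 := by
      apply mul_left_cancel₀ hc
      linear_combination h
    have h2 := congrArg Complex.im h1
    have h3 := congrArg Complex.re h1
    simp [τ.im_ne_zero] at h2
    simp [h2] at h3
    exact ⟨h2, h3⟩

/-- Scaling by c takes out c⁻ᵏ; the sum over all pairs is ζ(k) times the sum over coprime pairs,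
which is 2E. -/
lemma PeriodPair.G_ofUpperHalfPlane (τ : ℍ) {c : ℂ} (hc : c ≠ 0) {k : ℕ} (hk : 3 ≤ k) :
    (PeriodPair.ofUpperHalfPlane τ c hc).G k = 2 * riemannZeta k * E hk τ / c ^ k := by
  have h := tsum_eisSummand_eq_riemannZeta_mul_eisensteinSeries hk τ
  have hE : E hk τ = (1 / 2 : ℂ) * eisensteinSeries (N := 1) 0 k τ := rfl
  have : 2 * riemannZeta k * E hk τ / c ^ k = (∑' v, eisSummand k v τ) / c ^ k := by
    rw [h, hE]; ring
  rw [this, ← (finTwoArrowEquiv ℤ).symm.tsum_eq, PeriodPair.G,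
    ← (PeriodPair.ofUpperHalfPlane τ c hc).latticeEquivProd.symm.toEquiv.tsum_eq, ← tsum_div_const]
  refine tsum_congr fun x => ?_
  have e := (PeriodPair.ofUpperHalfPlane τ c hc).latticeEquiv_symm_apply x
  simp only [LinearEquiv.coe_toEquiv]
  rw [e]
  simp only [PeriodPair.ofUpperHalfPlane, eisSummand, finTwoArrowEquiv_symm_apply,
    Matrix.cons_val_zero, Matrix.cons_val_one, zpow_neg, zpow_natCast]
  rw [show (x.1 : ℂ) * (c * τ) + x.2 * c = (x.1 * τ + x.2) * c by ring, mul_pow, mul_inv,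
    div_eq_mul_inv]

lemma PeriodPair.exists_g₂_g₃_eq {g₂ g₃ : ℂ} (h2 : g₂ ≠ 0) (hΔ : g₂ ^ 3 ≠ 27 * g₃ ^ 2) :
    ∃ L : PeriodPair, L.g₂ = g₂ ∧ L.g₃ = g₃ := by
  obtain ⟨τ, hτ⟩ := exists_E₆_sq_eq_E₄_cube hΔ
  have hd := discriminant_ne_zero τ
  rw [discriminant_eq_E₄_cube_sub_E₆_sq] at hd
  have h4 : E₄ τ ≠ 0 := by
    intro h
    simp_all
  have hπ : (Real.pi : ℂ) ≠ 0 := by exact_mod_cast Real.pi_ne_zero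
  have z4 : riemannZeta (4 : ℕ) = Real.pi ^ 4 / 90 := by exact_mod_cast riemannZeta_four
  have z6 : riemannZeta (6 : ℕ) = Real.pi ^ 6 / 945 := by
    have h := riemannZeta_two_mul_nat (k := 3) (by norm_num)
    rw [show bernoulli (2 * 3) = 1 / 42 by decide +kernel] at h
    norm_num [Nat.factorial] at h ⊢
    rw [h]
    ring
  have key : ∀ c : ℂ, (hc : c ≠ 0) →
      (PeriodPair.ofUpperHalfPlane τ c hc).g₂ = 4 * Real.pi ^ 4 / 3 * E₄ τ / c ^ 4 ∧
      (PeriodPair.ofUpperHalfPlane τ c hc).g₃ = 8 * Real.pi ^ 6 / 27 * E₆ τ / c ^ 6 := by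
    intro c hc
    rw [PeriodPair.g₂, PeriodPair.g₃, PeriodPair.G_ofUpperHalfPlane τ hc (k := 4) (by norm_num),
      PeriodPair.G_ofUpperHalfPlane τ hc (k := 6) (by norm_num), z4, z6]
    constructor <;> ring
  -- The scale c is chosen to match g₂; the choice of τ then fixes g₃ up to sign.
  obtain ⟨c, hc4⟩ := IsAlgClosed.exists_pow_nat_eq (4 * Real.pi ^ 4 / 3 * E₄ τ / g₂)
    (n := 4) (by norm_num)
  have hc : c ≠ 0 := by
    rintro rfl
    rw [zero_pow (by norm_num), eq_comm, div_eq_zero_iff] at hc4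
    simp_all
  have e2 : 4 * Real.pi ^ 4 / 3 * E₄ τ / c ^ 4 = g₂ := by
    rw [hc4]; field_simp
  have e3 : (8 * Real.pi ^ 6 / 27 * E₆ τ / c ^ 6) ^ 2 = g₃ ^ 2 := by
    have e2' : 4 * Real.pi ^ 4 / 3 * E₄ τ = g₂ * c ^ 4 := by rw [← e2]; field_simp
    have e5 : g₂ ^ 3 * (8 * Real.pi ^ 6 / 27 * E₆ τ) ^ 2 = g₂ ^ 3 * (g₃ ^ 2 * c ^ 12) := by
      have : g₃ ^ 2 * (g₂ * c ^ 4) ^ 3 = g₃ ^ 2 * (4 * Real.pi ^ 4 / 3 * E₄ τ) ^ 3 := by rw [e2']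
      linear_combination 64 * (Real.pi : ℂ) ^ 12 / 729 * hτ - this
    have e6 := mul_left_cancel₀ (pow_ne_zero 3 h2) e5
    rw [div_pow, e6]
    field_simp
  rcases sq_eq_sq_iff_eq_or_eq_neg.1 e3 with h | h
  · exact ⟨_, (key c hc).1.trans e2, (key c hc).2.trans h⟩
  -- Replacing c by ic keeps c⁴ and negates c⁶, which corrects the sign of g₃.
  · have hci : Complex.I * c ≠ 0 := mul_ne_zero Complex.I_ne_zero hc
    refine ⟨_, (key _ hci).1.trans ?_, (key _ hci).2.trans ?_⟩
    · rw [mul_pow, Complex.I_pow_four, one_mul, e2]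
    · rw [mul_pow, show Complex.I ^ 6 = -1 by
        rw [show 6 = 4 + 2 by rfl, pow_add, Complex.I_pow_four, Complex.I_sq, one_mul],
        neg_one_mul, div_neg, h, neg_neg]

end LatticeExistence

/-! ### The Weierstrass formula and its differential equation -/

section EllipticSide

namespace PeriodPair

lemma eventually_nhdsNE_notMem_lattice (L : PeriodPair) (z : ℂ) :
    ∀ᶠ w in 𝓝[≠] z, w ∉ L.lattice := by
  filter_upwards [self_mem_nhdsWithin,
    mem_nhdsWithin_of_mem_nhds (L.compl_lattice_sdiff_singleton_mem_nhds z)] with w h1 h2 h3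
  exact h2 ⟨h3, h1⟩

/-- The pole at 0 shows that ℘ - c has finite order there, and finite order spreads over the
connected plane. -/
lemma eventually_nhdsNE_weierstrassP_ne (L : PeriodPair) (c z : ℂ) :
    ∀ᶠ w in 𝓝[≠] z, L.weierstrassP w ≠ c := by
  have hmero : Meromorphic fun w => L.weierstrassP w - c := by fun_prop
  have h0 : meromorphicOrderAt (fun w => L.weierstrassP w - c) 0 ≠ ⊤ := by
    rw [meromorphicOrderAt_ne_top_iff_eventually_ne_zero (hmero 0)]
    have ho := L.order_weierstrassP 0 L.lattice.zero_mem
    have ht := tendsto_cobounded_of_meromorphicOrderAt_neg (f := L.weierstrassP) (x := 0)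
      (by rw [ho]; decide)
    have := ht.eventually (Bornology.isBounded_def.1 (Bornology.isBounded_singleton (x := c)))
    filter_upwards [this] with w hw
    exact sub_ne_zero.2 hw
  have hz := hmero.meromorphicOn.meromorphicOrderAt_ne_top_of_isPreconnected
    isPreconnected_univ (Set.mem_univ 0) (Set.mem_univ z) h0
  rw [meromorphicOrderAt_ne_top_iff_eventually_ne_zero (hmero z)] at hz
  filter_upwards [hz] with w hw
  exact sub_ne_zero.1 hw

lemma hasDerivAt_weierstrassP (L : PeriodPair) {z : ℂ} (hz : z ∉ L.lattice) :
    HasDerivAt L.weierstrassP (L.derivWeierstrassP z) z := by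
  have h := (L.analyticOnNhd_weierstrassP z hz).differentiableAt.hasDerivAt
  rwa [L.deriv_weierstrassP] at h

lemma isOpen_compl_lattice (L : PeriodPair) : IsOpen ((L.lattice : Set ℂ)ᶜ) :=
  L.isClosed_lattice.isOpen_compl

variable {L : PeriodPair} {a : ℂ}

lemma derivWeierstrassP_sq_of_invariants (h2 : L.g₂ = (1 + 48 * a ^ 2) / 12)
    (h3 : L.g₃ = (1 - 144 * a ^ 2) / 216) {z : ℂ} (hz : z ∉ L.lattice) :
    L.derivWeierstrassP z ^ 2 =
      (4 * (1 / 12 + L.weierstrassP z) - 1) * ((1 / 12 + L.weierstrassP z) ^ 2 - a ^ 2) := by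
  rw [L.derivWeierstrassP_sq z hz, h2, h3]
  ring

/-- Differentiate the equation for ℘'² and cancel 2℘'. -/
lemma hasDerivAt_derivWeierstrassP_of_invariants (h2 : L.g₂ = (1 + 48 * a ^ 2) / 12)
    (h3 : L.g₃ = (1 - 144 * a ^ 2) / 216) {z : ℂ} (hz : z ∉ L.lattice)
    (hne : L.derivWeierstrassP z ≠ 0) :
    HasDerivAt L.derivWeierstrassP
      (2 * ((1 / 12 + L.weierstrassP z) ^ 2 - a ^ 2) +
        (1 / 12 + L.weierstrassP z) * (4 * (1 / 12 + L.weierstrassP z) - 1)) z := by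
  have hd := (L.analyticOnNhd_derivWeierstrassP z hz).differentiableAt.hasDerivAt
  have hx := (L.hasDerivAt_weierstrassP hz).const_add (1 / 12)
  have e1 := hd.fun_pow 2
  have e2 := ((hx.const_mul 4).sub_const 1).fun_mul ((hx.fun_pow 2).sub_const (a ^ 2))
  have e3 := e1.unique (e2.congr_of_eventuallyEq (by
    filter_upwards [L.isOpen_compl_lattice.mem_nhds hz] with w hw
    exact derivWeierstrassP_sq_of_invariants h2 h3 hw))
  refine hd.congr_deriv (mul_left_cancel₀ (mul_ne_zero two_ne_zero hne) ?_)
  simp only [Nat.cast_ofNat, Nat.add_one_sub_one, pow_one] at e3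
  linear_combination e3

end PeriodPair

/-- The function `a ℘' / (a ^ 2 - (1 / 12 + ℘) ^ 2)`, whose normal form extends `rn`. -/
noncomputable def rnFormula (L : PeriodPair) (a z : ℂ) : ℂ :=
  a * L.derivWeierstrassP z / (a ^ 2 - (1 / 12 + L.weierstrassP z) ^ 2)

/-- The derivative of `rnFormula`. -/
noncomputable def rnFormulaDeriv (L : PeriodPair) (a z : ℂ) : ℂ :=
  a * (2 * (1 / 12 + L.weierstrassP z) ^ 2 - (1 / 12 + L.weierstrassP z) + 2 * a ^ 2) /
    ((1 / 12 + L.weierstrassP z) ^ 2 - a ^ 2)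

variable {L : PeriodPair} {a : ℂ}

lemma meromorphic_rnFormula (L : PeriodPair) (a : ℂ) : Meromorphic (rnFormula L a) := by
  unfold rnFormula
  fun_prop

lemma analyticAt_rnFormula {z : ℂ} (hz : z ∉ L.lattice)
    (hne : a ^ 2 - (1 / 12 + L.weierstrassP z) ^ 2 ≠ 0) : AnalyticAt ℂ (rnFormula L a) z :=
  (analyticAt_const.mul (L.analyticOnNhd_derivWeierstrassP z hz)).fun_div
    (analyticAt_const.sub ((analyticAt_const.add (L.analyticOnNhd_weierstrassP z hz)).pow 2)) hne

lemma rnFormula_add_coe {l : ℂ} (hl : l ∈ L.lattice) (z : ℂ) :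
    rnFormula L a (z + l) = rnFormula L a z := by
  lift l to L.lattice using hl
  simp [rnFormula]

lemma rnFormula_sq_mul (h2 : L.g₂ = (1 + 48 * a ^ 2) / 12)
    (h3 : L.g₃ = (1 - 144 * a ^ 2) / 216) {z : ℂ} (hz : z ∉ L.lattice)
    (hne : a ^ 2 - (1 / 12 + L.weierstrassP z) ^ 2 ≠ 0) :
    rnFormula L a z ^ 2 * ((1 / 12 + L.weierstrassP z) ^ 2 - a ^ 2) =
      a ^ 2 * (4 * (1 / 12 + L.weierstrassP z) - 1) := by
  rw [rnFormula, div_pow, mul_pow, L.derivWeierstrassP_sq_of_invariants h2 h3 hz]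
  generalize 1 / 12 + L.weierstrassP z = x at *
  field_simp
  ring

lemma hasDerivAt_rnFormula (h2 : L.g₂ = (1 + 48 * a ^ 2) / 12)
    (h3 : L.g₃ = (1 - 144 * a ^ 2) / 216) {z : ℂ} (hz : z ∉ L.lattice)
    (hne : L.derivWeierstrassP z ≠ 0) :
    HasDerivAt (rnFormula L a) (rnFormulaDeriv L a z) z := by
  have hsq := L.derivWeierstrassP_sq_of_invariants h2 h3 hz
  have hx := (L.hasDerivAt_weierstrassP hz).const_add (1 / 12)
  have hD : a ^ 2 - (1 / 12 + L.weierstrassP z) ^ 2 ≠ 0 := by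
    intro h
    apply hne
    rw [← sq_eq_zero_iff, hsq]
    linear_combination -(4 * (1 / 12 + L.weierstrassP z) - 1) * h
  have hD' : (1 / 12 + L.weierstrassP z) ^ 2 - a ^ 2 ≠ 0 := by
    rwa [← neg_ne_zero, neg_sub]
  refine (((L.hasDerivAt_derivWeierstrassP_of_invariants h2 h3 hz hne).const_mul a).fun_div
    ((hx.fun_pow 2).const_sub (a ^ 2)) hD).congr_deriv ?_
  rw [rnFormulaDeriv]
  generalize 1 / 12 + L.weierstrassP z = x at *
  generalize L.derivWeierstrassP z = y at *
  rw [div_eq_div_iff (pow_ne_zero 2 hD) hD']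
  simp only [Nat.cast_ofNat, Nat.add_one_sub_one, pow_one]
  linear_combination (2 * a * x * (x ^ 2 - a ^ 2)) * hsq

lemma hasDerivAt_rnFormulaDeriv (h2 : L.g₂ = (1 + 48 * a ^ 2) / 12)
    (h3 : L.g₃ = (1 - 144 * a ^ 2) / 216) {z : ℂ} (hz : z ∉ L.lattice)
    (hne : L.derivWeierstrassP z ≠ 0) :
    HasDerivAt (rnFormulaDeriv L a) (2 * rnFormula L a z ^ 3 - rnFormula L a z) z := by
  have hsq := L.derivWeierstrassP_sq_of_invariants h2 h3 hz
  have hx := (L.hasDerivAt_weierstrassP hz).const_add (1 / 12)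
  have hD : a ^ 2 - (1 / 12 + L.weierstrassP z) ^ 2 ≠ 0 := by
    intro h
    apply hne
    rw [← sq_eq_zero_iff, hsq]
    linear_combination -(4 * (1 / 12 + L.weierstrassP z) - 1) * h
  have hD' : (1 / 12 + L.weierstrassP z) ^ 2 - a ^ 2 ≠ 0 := by
    rwa [← neg_ne_zero, neg_sub]
  refine ((((((hx.fun_pow 2).const_mul 2).fun_sub hx).add_const (2 * a ^ 2)).const_mul a).fun_div
    ((hx.fun_pow 2).sub_const (a ^ 2)) hD').congr_deriv ?_
  rw [rnFormula]
  generalize 1 / 12 + L.weierstrassP z = x at *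
  generalize L.derivWeierstrassP z = y at *
  simp only [Nat.cast_ofNat, Nat.add_one_sub_one, pow_one]
  have hy : y ^ 3 = y * ((4 * x - 1) * (x ^ 2 - a ^ 2)) := by rw [← hsq]; ring
  rw [show a ^ 2 - x ^ 2 = -(x ^ 2 - a ^ 2) by ring, div_pow, mul_pow, hy]
  field_simp
  ring

lemma eventually_nhdsNE_regular (h2 : L.g₂ = (1 + 48 * a ^ 2) / 12)
    (h3 : L.g₃ = (1 - 144 * a ^ 2) / 216) (z : ℂ) :
    ∀ᶠ w in 𝓝[≠] z, w ∉ L.lattice ∧ L.derivWeierstrassP w ≠ 0 ∧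
      a ^ 2 - (1 / 12 + L.weierstrassP w) ^ 2 ≠ 0 := by
  -- The values 1/6 and ±a - 1/12 of ℘ are the roots x = 1/4, ±a of the cubic.
  filter_upwards [L.eventually_nhdsNE_notMem_lattice z,
    L.eventually_nhdsNE_weierstrassP_ne (1 / 6) z,
    L.eventually_nhdsNE_weierstrassP_ne (a - 1 / 12) z,
    L.eventually_nhdsNE_weierstrassP_ne (-a - 1 / 12) z] with w hw e1 e2 e3
  have hD : a ^ 2 - (1 / 12 + L.weierstrassP w) ^ 2 ≠ 0 := by
    rw [sq_sub_sq]
    refine mul_ne_zero (fun h => e3 ?_) (fun h => e2 ?_)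
    · linear_combination h
    · linear_combination -h
  refine ⟨hw, fun h => ?_, hD⟩
  have hsq := L.derivWeierstrassP_sq_of_invariants h2 h3 hw
  rw [h, zero_pow two_ne_zero, zero_eq_mul] at hsq
  rcases hsq with h | h
  · exact e1 (by linear_combination h / 4)
  · exact hD (by linear_combination -h)

/-! ### The normal form of the formula -/

/-- A meromorphic function in normal form which agrees with `rnFormula L a` away from isolated
points. -/
def IsRnExtension (L : PeriodPair) (a : ℂ) (R : ℂ → ℂ) : Prop :=
  MeromorphicNFOn R Set.univ ∧ ∀ z, R =ᶠ[𝓝[≠] z] rnFormula L a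

lemma exists_isRnExtension (L : PeriodPair) (a : ℂ) : ∃ R, IsRnExtension L a R :=
  ⟨toMeromorphicNFOn (rnFormula L a) Set.univ, meromorphicNFOn_toMeromorphicNFOn _ _,
    fun _ => (meromorphic_rnFormula L a).meromorphicOn.toMeromorphicNFOn_eq_self_on_nhdsNE
      (Set.mem_univ _)⟩

namespace IsRnExtension

variable {R : ℂ → ℂ} (hR : IsRnExtension L a R)
include hR

lemma eventuallyEq_nhds {z : ℂ} {h : ℂ → ℂ} (hh : MeromorphicNFAt h z)
    (he : rnFormula L a =ᶠ[𝓝[≠] z] h) : R =ᶠ[𝓝 z] h :=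
  ((hR.1 (Set.mem_univ z)).eventuallyEq_nhdsNE_iff_eventuallyEq_nhds hh).1 ((hR.2 z).trans he)

lemma apply_eq {z : ℂ} (hz : z ∉ L.lattice)
    (hne : a ^ 2 - (1 / 12 + L.weierstrassP z) ^ 2 ≠ 0) : R z = rnFormula L a z :=
  (hR.eventuallyEq_nhds (analyticAt_rnFormula hz hne).meromorphicNFAt .rfl).eq_of_nhds

lemma isEllipticWith : IsEllipticWith L R := by
  refine ⟨hR.1, fun l hl z => ?_⟩
  have hnf : MeromorphicNFAt (R ∘ (· + l)) z :=
    meromorphicNFAt_comp_add_const_iff_meromorphicNFAt.2 (hR.1 (Set.mem_univ _))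
  have ht : Tendsto (· + l) (𝓝[≠] z) (𝓝[≠] (z + l)) :=
    ((continuous_add_const l).tendsto z).inf (by simp)
  have he : rnFormula L a =ᶠ[𝓝[≠] z] R ∘ (· + l) := by
    filter_upwards [ht.eventually (hR.2 (z + l))] with w hw
    rw [Function.comp_apply, hw, rnFormula_add_coe hl]
  exact (hR.eventuallyEq_nhds hnf he).eq_of_nhds.symm

/-- Clearing the poles of ℘ and ℘' with z⁴ turns the formula into z q(z), where q is analytic and
q(0) = 2a. -/
lemma eventuallyEq_nhds_zero : ∃ h : ℂ → ℂ, R =ᶠ[𝓝 0] h ∧ AnalyticAt ℂ h 0 ∧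
    h 0 = 0 ∧ HasDerivAt h (2 * a) 0 := by
  set E := L.weierstrassPExcept 0
  set E' := L.derivWeierstrassPExcept 0
  have hE : AnalyticAt ℂ E 0 := L.analyticAt_weierstrassPExcept 0
  have hE' : AnalyticAt ℂ E' 0 := L.analyticAt_derivWeierstrassPExcept 0
  let q : ℂ → ℂ := fun z => a * (z ^ 3 * E' z - 2) /
    (a ^ 2 * z ^ 4 - (z ^ 2 * (1 / 12 + E z) + 1) ^ 2)
  have hq : AnalyticAt ℂ q 0 := by
    refine AnalyticAt.fun_div (by fun_prop) (by fun_prop) (by simp)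
  have hq0 : q 0 = 2 * a := by simp [q]; ring
  have hm : AnalyticAt ℂ (fun z => z * q z) 0 := analyticAt_id.mul hq
  refine ⟨fun z => z * q z, hR.eventuallyEq_nhds hm.meromorphicNFAt ?_, hm, by simp, ?_⟩
  · filter_upwards [self_mem_nhdsWithin] with z (hz : z ≠ 0)
    have e1 := L.weierstrassPExcept_add 0 z
    have e2 := L.derivWeierstrassPExcept_sub 0 z
    simp only [ZeroMemClass.coe_zero, sub_zero] at e1 e2
    rw [rnFormula, ← e1, ← e2]
    have hnum : a * (E' z - 2 / z ^ 3) = a * (z ^ 3 * E' z - 2) / z ^ 3 := by field_simp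
    -- The term 1 / 0 ^ 2 is 0 by convention.
    have hden : a ^ 2 - (1 / 12 + (E z + (1 / z ^ 2 - 1 / 0 ^ 2))) ^ 2 =
        (a ^ 2 * z ^ 4 - (z ^ 2 * (1 / 12 + E z) + 1) ^ 2) / z ^ 4 := by
      field_simp
      ring
    change a * (E' z - 2 / z ^ 3) / (a ^ 2 - (1 / 12 + (E z + (1 / z ^ 2 - 1 / 0 ^ 2))) ^ 2) = _
    rw [hnum, hden]
    simp only [q]
    generalize a * (z ^ 3 * E' z - 2) = A
    generalize a ^ 2 * z ^ 4 - (z ^ 2 * (1 / 12 + E z) + 1) ^ 2 = B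
    rcases eq_or_ne B 0 with rfl | hB
    · simp
    · field_simp
  · have := (hasDerivAt_id (0 : ℂ)).fun_mul hq.differentiableAt.hasDerivAt
    simpa [hq0] using this

lemma analyticAt_zero : AnalyticAt ℂ R 0 := by
  obtain ⟨h, he, ha, -, -⟩ := hR.eventuallyEq_nhds_zero
  exact ha.congr he.symm

lemma apply_zero : R 0 = 0 := by
  obtain ⟨h, he, -, h0, -⟩ := hR.eventuallyEq_nhds_zero
  exact he.eq_of_nhds.trans h0

lemma deriv_zero : deriv R 0 = 2 * a := by
  obtain ⟨h, he, -, -, hd⟩ := hR.eventuallyEq_nhds_zero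
  exact he.deriv_eq.trans hd.deriv

/-- The equation holds at nearby regular points and passes to z by continuity. -/
lemma deriv_deriv (h2 : L.g₂ = (1 + 48 * a ^ 2) / 12) (h3 : L.g₃ = (1 - 144 * a ^ 2) / 216)
    {z : ℂ} (hz : AnalyticAt ℂ R z) : deriv (deriv R) z = 2 * R z ^ 3 - R z := by
  have hc1 : ContinuousAt (deriv (deriv R)) z := hz.deriv.deriv.continuousAt
  have hc2 : ContinuousAt (fun w => 2 * R w ^ 3 - R w) z := by
    have := hz.continuousAt
    fun_prop
  have heq : ∀ᶠ w in 𝓝[≠] z, deriv (deriv R) w = 2 * R w ^ 3 - R w := by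
    have hev := (hR.2 z).and (eventually_nhdsNE_regular h2 h3 z)
    rw [← eventually_eventually_nhdsWithin] at hev
    filter_upwards [hev, self_mem_nhdsWithin] with w hw hwz
    rw [isOpen_compl_singleton.nhdsWithin_eq hwz] at hw
    have hRf : R =ᶠ[𝓝 w] rnFormula L a := hw.mono fun _ h => h.1
    have hd : deriv R =ᶠ[𝓝 w] rnFormulaDeriv L a := by
      filter_upwards [hRf.deriv, hw] with y hy hy'
      rw [hy, (hasDerivAt_rnFormula h2 h3 hy'.2.1 hy'.2.2.1).deriv]
    obtain ⟨e, r1, r2, -⟩ := hw.self_of_nhds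
    rw [hd.deriv_eq, (hasDerivAt_rnFormulaDeriv h2 h3 r1 r2).deriv, e]
  exact tendsto_nhds_unique_of_eventuallyEq (hc1.tendsto.mono_left nhdsWithin_le_nhds)
    (hc2.tendsto.mono_left nhdsWithin_le_nhds) heq

/-- By continuity R²(x² - a²) = a²(4x - 1) holds at z. If x² = a² there, then x = 1/4 and 16a² = 1.
-/
lemma denom_ne_zero_of_analyticAt (h2 : L.g₂ = (1 + 48 * a ^ 2) / 12)
    (h3 : L.g₃ = (1 - 144 * a ^ 2) / 216) (ha : a ≠ 0) (ha' : 16 * a ^ 2 ≠ 1) {z : ℂ}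
    (hz : z ∉ L.lattice) (hRz : AnalyticAt ℂ R z) :
    a ^ 2 - (1 / 12 + L.weierstrassP z) ^ 2 ≠ 0 := by
  have hP : ContinuousAt L.weierstrassP z := (L.analyticOnNhd_weierstrassP z hz).continuousAt
  have hRc := hRz.continuousAt
  have hc1 : ContinuousAt
      (fun w => R w ^ 2 * ((1 / 12 + L.weierstrassP w) ^ 2 - a ^ 2)) z := by fun_prop
  have hc2 : ContinuousAt (fun w => a ^ 2 * (4 * (1 / 12 + L.weierstrassP w) - 1)) z := by
    fun_prop
  have heq : ∀ᶠ w in 𝓝[≠] z, R w ^ 2 * ((1 / 12 + L.weierstrassP w) ^ 2 - a ^ 2) =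
      a ^ 2 * (4 * (1 / 12 + L.weierstrassP w) - 1) := by
    filter_upwards [hR.2 z, eventually_nhdsNE_regular h2 h3 z] with w hw hw2
    rw [hw, rnFormula_sq_mul h2 h3 hw2.1 hw2.2.2]
  have h := tendsto_nhds_unique_of_eventuallyEq (hc1.tendsto.mono_left nhdsWithin_le_nhds)
    (hc2.tendsto.mono_left nhdsWithin_le_nhds) heq
  intro h0
  rw [show (1 / 12 + L.weierstrassP z) ^ 2 - a ^ 2 = 0 by linear_combination -h0, mul_zero,
    zero_eq_mul, sq_eq_zero_iff] at h
  rcases h with h | h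
  · exact ha h
  · apply ha'
    linear_combination 16 * h0 + (4 * (1 / 12 + L.weierstrassP z) + 1) * h

end IsRnExtension

end EllipticSide

/-! ### Uniqueness and continuation along the real line -/

/-- The phase space form of `y'' = 2 y ^ 3 - y`. -/
def rnField (p : ℂ × ℂ) : ℂ × ℂ :=
  (p.2, 2 * p.1 ^ 3 - p.1)

lemma eventuallyEq_of_hasDerivAt_rnField {f g : ℝ → ℂ × ℂ} {t : ℝ}
    (hf : ∀ᶠ s in 𝓝 t, HasDerivAt f (rnField (f s)) s)
    (hg : ∀ᶠ s in 𝓝 t, HasDerivAt g (rnField (g s)) s) (h : f t = g t) : f =ᶠ[𝓝 t] g := by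
  have hC : ContDiff ℝ 1 rnField := by
    unfold rnField
    fun_prop
  obtain ⟨K, S, hS, hK⟩ := hC.contDiffAt.exists_lipschitzOnWith (x := f t)
  refine ODE_solution_unique_of_eventually (v := fun _ => rnField) (s := fun _ => S) (K := K)
    (Eventually.of_forall fun _ => hK) ?_ ?_ h
  · exact hf.and (hf.self_of_nhds.continuousAt.eventually_mem hS)
  · exact hg.and (hg.self_of_nhds.continuousAt.eventually_mem (h ▸ hS))

/-- The curve `(rn, rn')`, with complex coordinates. -/
noncomputable def rnCurve (κ u : ℝ) : ℂ × ℂ :=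
  ((rn κ u : ℂ), (rnDeriv κ u : ℂ))

lemma hasDerivAt_rnCurve {κ : ℝ} (h0 : 0 < κ) (h1 : κ < 1) (u : ℝ) :
    HasDerivAt (rnCurve κ) (rnField (rnCurve κ u)) u := by
  convert! (hasDerivAt_rn h0 h1 u).ofReal_comp.prodMk (hasDerivAt_rnDeriv h0 h1 u).ofReal_comp
    using 1
  simp [rnField, rnCurve]

namespace IsRnExtension

variable {L : PeriodPair} {κ : ℝ} {R : ℂ → ℂ}

lemma analyticAt_and_eq_rnCurve (hR : IsRnExtension L ((κ : ℂ) / 4) R) (hκ0 : 0 < κ) (hκ1 : κ < 1)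
    (h2 : L.g₂ = (1 + 48 * ((κ : ℂ) / 4) ^ 2) / 12)
    (h3 : L.g₃ = (1 - 144 * ((κ : ℂ) / 4) ^ 2) / 216) (u : ℝ) :
    AnalyticAt ℂ R u ∧ (R u, deriv R u) = rnCurve κ u := by
  let S : Set ℝ := {u | AnalyticAt ℂ R u ∧ (R u, deriv R u) = rnCurve κ u}
  have hcont : Continuous (rnCurve κ) :=
    continuous_iff_continuousAt.2 fun u => (hasDerivAt_rnCurve hκ0 hκ1 u).continuousAt
  have hofReal (t : ℝ) : Tendsto (fun s : ℝ => (s : ℂ)) (𝓝 t) (𝓝 (t : ℂ)) :=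
    Complex.continuous_ofReal.tendsto t
  have hzero : (0 : ℝ) ∈ S := by
    refine ⟨by simpa using hR.analyticAt_zero, ?_⟩
    rw [rnCurve, rn_zero hκ0 hκ1, rnDeriv_zero hκ0 hκ1, Complex.ofReal_zero, hR.apply_zero,
      hR.deriv_zero]
    push_cast
    ring_nf
  have hopen : IsOpen S := by
    rw [isOpen_iff_mem_nhds]
    rintro t ⟨ha, he⟩
    have hev : ∀ᶠ s : ℝ in 𝓝 t, AnalyticAt ℂ R s := (hofReal t).eventually ha.eventually_analyticAt
    have := eventuallyEq_of_hasDerivAt_rnField (f := fun s : ℝ => (R s, deriv R s))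
      (g := rnCurve κ) (t := t) ?_ (Eventually.of_forall (hasDerivAt_rnCurve hκ0 hκ1)) he
    · filter_upwards [hev, this] with s e1 e2
      exact ⟨e1, e2⟩
    · filter_upwards [hev] with s hs
      have d1 := hs.differentiableAt.hasDerivAt.comp_ofReal
      have d2 := hs.deriv.differentiableAt.hasDerivAt.comp_ofReal
      rw [hR.deriv_deriv h2 h3 hs] at d2
      exact d1.prodMk d2
  have hclosed : IsClosed S := by
    rw [isClosed_iff_frequently]
    intro t ht
    -- Assuming t ∉ S, its approximation by S takes place in the punctured neighbourhood, where the
    -- growth of `R` at a pole can be used.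
    by_cases htS : t ∈ S
    · exact htS
    have hfr : ∃ᶠ s in 𝓝[≠] t, s ∈ S := by
      rw [frequently_nhdsWithin_iff]
      exact ht.mono fun s hs => ⟨hs, fun h => htS (h ▸ hs)⟩
    have hto : Tendsto (fun s : ℝ => (s : ℂ)) (𝓝[≠] t) (𝓝[≠] (t : ℂ)) :=
      (hofReal t).inf (by simp)
    have ha : AnalyticAt ℂ R t := by
      rw [← (hR.1 (Set.mem_univ _)).meromorphicOrderAt_nonneg_iff_analyticAt]
      -- At a pole `R` is unbounded near t, yet at points of S close to t it equals rn, which is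
      -- bounded there.
      by_contra! hneg
      have hcb := (tendsto_norm_cobounded_atTop.comp
        (tendsto_cobounded_of_meromorphicOrderAt_neg hneg)).comp hto
      have hbd : ∀ᶠ s in 𝓝[≠] t, ‖rnCurve κ s‖ < ‖rnCurve κ t‖ + 1 :=
        (hcont.norm.tendsto t).mono_left nhdsWithin_le_nhds |>.eventually_lt_const (by linarith)
      obtain ⟨s, hs, hs1, hs2⟩ :=
        (hfr.and_eventually (hbd.and (hcb.eventually_gt_atTop (‖rnCurve κ t‖ + 1)))).exists
      have hs3 := norm_fst_le (rnCurve κ s)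
      rw [← hs.2] at hs3 hs1
      simp only [Function.comp_apply] at hs2
      linarith
    refine ⟨ha, ?_⟩
    have hc : Tendsto (fun s : ℝ => (R s, deriv R s)) (𝓝[≠] t) (𝓝 (R t, deriv R t)) :=
      ((ha.continuousAt.tendsto.comp (hofReal t)).prodMk_nhds
        (ha.deriv.continuousAt.tendsto.comp (hofReal t))).mono_left nhdsWithin_le_nhds
    exact tendsto_nhds_unique_of_frequently_eq hc
      ((hcont.tendsto t).mono_left nhdsWithin_le_nhds) (hfr.mono fun s hs => hs.2)
  have : S = Set.univ := IsClopen.eq_univ ⟨hclosed, hopen⟩ ⟨0, hzero⟩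
  exact Set.eq_univ_iff_forall.1 this u

end IsRnExtension

theorem theoremP (κ : ℝ) (hκ0 : 0 < κ) (hκ1 : κ < 1) :
    (∃ L : PeriodPair,
      L.g₂ = (1 + 3 * (κ : ℂ) ^ 2) / 12 ∧ L.g₃ = (1 - 9 * (κ : ℂ) ^ 2) / 216) ∧
    ∀ L : PeriodPair,
      L.g₂ = (1 + 3 * (κ : ℂ) ^ 2) / 12 → L.g₃ = (1 - 9 * (κ : ℂ) ^ 2) / 216 →
      (∀ u : ℝ, (u : ℂ) ∉ L.lattice →
        ((κ : ℂ) / 4) ^ 2 - (1 / 12 + L.weierstrassP u) ^ 2 ≠ 0 ∧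
        (rn κ u : ℂ) = (κ : ℂ) / 4 * L.derivWeierstrassP u /
          (((κ : ℂ) / 4) ^ 2 - (1 / 12 + L.weierstrassP u) ^ 2) ∧
        (rn κ u : ℂ) = (κ : ℂ) / 4 * L.derivWeierstrassP u /
          (((κ : ℂ) / 4 - 1 / 12 - L.weierstrassP u) *
            ((κ : ℂ) / 4 + 1 / 12 + L.weierstrassP u))) ∧
      ∃ R : ℂ → ℂ, IsEllipticWith L R ∧
        (∀ u : ℝ, AnalyticAt ℂ R u ∧ R u = (rn κ u : ℂ)) ∧
        ∀ z : ℂ, z ∉ L.lattice →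
          ((κ : ℂ) / 4) ^ 2 - (1 / 12 + L.weierstrassP z) ^ 2 ≠ 0 →
          R z = (κ : ℂ) / 4 * L.derivWeierstrassP z /
            (((κ : ℂ) / 4) ^ 2 - (1 / 12 + L.weierstrassP z) ^ 2) ∧
          R z = (κ : ℂ) / 4 * L.derivWeierstrassP z /
            (((κ : ℂ) / 4 - 1 / 12 - L.weierstrassP z) *
              ((κ : ℂ) / 4 + 1 / 12 + L.weierstrassP z)) := by
  have hκsq : κ ^ 2 < 1 := by nlinarith
  constructor
  · apply PeriodPair.exists_g₂_g₃_eq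
    · have : (1 + 3 * κ ^ 2) / 12 ≠ 0 := by positivity
      exact_mod_cast this
    · have : ((1 + 3 * κ ^ 2) / 12) ^ 3 ≠ 27 * ((1 - 9 * κ ^ 2) / 216) ^ 2 := by
        intro h
        -- Here g₂³ - 27g₃² = κ²(1 - κ²)²/64.
        have h' : κ ^ 2 * (1 - κ ^ 2) ^ 2 = 0 := by linear_combination 64 * h
        have : 0 < κ ^ 2 * (1 - κ ^ 2) ^ 2 := by
          have : 0 < 1 - κ ^ 2 := by linarith
          positivity
        linarith
      exact_mod_cast this
  intro L h2 h3
  replace h2 : L.g₂ = (1 + 48 * ((κ : ℂ) / 4) ^ 2) / 12 := by rw [h2]; ring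
  replace h3 : L.g₃ = (1 - 144 * ((κ : ℂ) / 4) ^ 2) / 216 := by rw [h3]; ring
  obtain ⟨R, hR⟩ := exists_isRnExtension L ((κ : ℂ) / 4)
  have hreal (u : ℝ) : AnalyticAt ℂ R u ∧ R u = (rn κ u : ℂ) :=
    (hR.analyticAt_and_eq_rnCurve hκ0 hκ1 h2 h3 u).imp_right fun h => congrArg Prod.fst h
  have ha : (κ : ℂ) / 4 ≠ 0 := by
    have : κ / 4 ≠ 0 := by positivity
    exact_mod_cast this
  have ha' : 16 * ((κ : ℂ) / 4) ^ 2 ≠ 1 := by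
    have : 16 * (κ / 4) ^ 2 ≠ 1 := by
      intro h
      linarith [show 16 * (κ / 4) ^ 2 = κ ^ 2 by ring]
    exact_mod_cast this
  have hfactor (z : ℂ) : ((κ : ℂ) / 4 - 1 / 12 - L.weierstrassP z) *
      ((κ : ℂ) / 4 + 1 / 12 + L.weierstrassP z) =
      ((κ : ℂ) / 4) ^ 2 - (1 / 12 + L.weierstrassP z) ^ 2 := by ring
  simp only [hfactor, and_self]
  refine ⟨fun u hu => ?_, R, hR.isEllipticWith, hreal, fun z hz hne => hR.apply_eq hz hne⟩
  have hne := hR.denom_ne_zero_of_analyticAt h2 h3 ha ha' hu (hreal u).1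
  exact ⟨hne, (hreal u).2 ▸ hR.apply_eq hu hne⟩
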